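/- Let $H$ be a real Hilbert space, $D\subset H$, and $F:D\to H$ monotone, $(F(u)-F(v),u-v)\ge 0$ for all $u,v\in D$, and locally Lipschitz on $D$. Write $B(u_0,\rho)=\{u\in H:\|u-u_0\|\le\rho\}$. Let $u_0\in H$, $R>0$, $B(u_0,R)\subset D$, and suppose that $F$ is twice Fréchet differentiable on $B(u_0,R)$ with $\sup_{u\in B(u_0,R)}\|F^{(j)}(u)\|\le M_j<\infty$ for $j=1,2$. Suppose that $F(z)=0$ for some $z\in B(u_0,R)$ such that $B(u_0,3(\|z\|+\|u_0\|))\subset D$ (both inclusions are automatic if $D=H$). Let $\epsilon:[0,\infty)\to(0,\infty)$ be continuous and non-increasing with $\epsilon(t)\to0$ as $t\to\infty$, differentiable on $(0,\infty)$, and such that $\dot\epsilon(t)/\epsilon(t)^2\to0$ as $t\to\infty$. Then $F$ has a unique zero $y$ of minimal norm in $D$, and the Cauchy problem $$\dot u(t)=-F(u(t))-\epsilon(t)u(t),\quad t\ge 0,\qquad u(0)=u_0,$$ has a unique global solution $u:[0,\infty)\to D$, and $\lim_{t\to\infty}\|u(t)-y\|=0$. In particular $u(\infty)=\lim_{t\to\infty}u(t)$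 exists and $F(u(\infty))=0$. -/

import Mathlib

open Set Filter Topology Metric

/-- `F` is monotone on the set `D` of a real Hilbert space:
`(F u - F v, u - v) ≥ 0` for all `u, v ∈ D`. -/
def MonotoneOperatorOn {H : Type*} [NormedAddCommGroup H] [InnerProductSpace ℝ H]
    (F : H → H) (D : Set H) : Prop :=
  ∀ u ∈ D, ∀ v ∈ D, 0 ≤ inner ℝ (F u - F v) (u - v)

/-- `F` is twice Fréchet differentiable on the closed ball `B = {u | ‖u - u₀‖ ≤ R}`, and its first
and second Fréchet derivatives are bounded there by `M₁` and `M₂`. Derivatives are taken within `B`,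
so that on the boundary sphere only the values of `F` in `B` matter; for `R > 0` they are unique,
and they are the usual derivatives wherever those exist. -/
def HasBoundedDerivatives {H : Type*} [NormedAddCommGroup H] [InnerProductSpace ℝ H]
    (F : H → H) (u₀ : H) (R M₁ M₂ : ℝ) : Prop :=
  DifferentiableOn ℝ F (closedBall u₀ R) ∧
  DifferentiableOn ℝ (fderivWithin ℝ F (closedBall u₀ R)) (closedBall u₀ R) ∧
  (∀ u ∈ closedBall u₀ R, ‖fderivWithin ℝ F (closedBall u₀ R) u‖ ≤ M₁) ∧
  (∀ u ∈ closedBall u₀ R,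
    ‖fderivWithin ℝ (fderivWithin ℝ F (closedBall u₀ R)) (closedBall u₀ R) u‖ ≤ M₂)

/-- `u` is a global solution, with values in `D`, of the Cauchy problem
`u'(t) = Φ (t, u(t))` for `t ≥ 0`, `u(0) = u₀` (the derivative at `t = 0` is the right one;
at `t > 0` the derivative within `[0, ∞)` is the ordinary two-sided one). -/
def IsGlobalSolution {H : Type*} [NormedAddCommGroup H] [InnerProductSpace ℝ H]
    (Φ : ℝ → H → H) (D : Set H) (u₀ : H) (u : ℝ → H) : Prop :=
  u 0 = u₀ ∧ ∀ t : ℝ, 0 ≤ t → u t ∈ D ∧ HasDerivWithinAt u (Φ t (u t)) (Ici 0) t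

/-- `y` is the unique zero of minimal norm of `F` in `D`. -/
def IsMinimalNormZero {H : Type*} [NormedAddCommGroup H] [InnerProductSpace ℝ H]
    (F : H → H) (D : Set H) (y : H) : Prop :=
  y ∈ D ∧ F y = 0 ∧ ∀ x ∈ D, F x = 0 → x ≠ y → ‖y‖ < ‖x‖

/-! The trajectory is compared with the zeros `w a` of `F + a`, `a > 0`. Adding `a` makes the
monotone operator strongly monotone, so every estimate comes from testing the difference of two
paths against the difference of their velocities.

Comparison with the rest point `z` keeps solutions in the closed ball about `z` of radius `max ‖u₀ -
z‖ ‖z‖`, which lies in an open subset of `D`. In infinite dimensions local Lipschitz continuity does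
not bound `F` on that ball, so the velocity has no evident bound up to a finite endpoint. Instead a
solution is compared with its own time shift: its modulus of continuity at `0` controls the one at
later times, so it converges at the endpoint and continues.

The same flow with constant parameter `a` contracts exponentially, and its limit is `w a`. As `a`
decreases, `‖w a‖` increases but is bounded by `‖z‖`; the inequality `‖w a‖² + ‖w a - w b‖² ≤ ‖w
b‖²` for `b ≤ a` (`sq_norm_add_sq_norm_sub_le`) makes `w` Cauchy at `0`, with limit the minimal-norm
zero `y`.

Finally `u t` is attracted to `w (ε t)` at rate `ε`, while this target moves at speed at most a
constant times `|ε'| / ε`. The lag is governed by the ratio `|ε'| / ε²`, which tends to `0`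
(`tendsto_sub_of_slow_target`). -/

/-! ### Barrier estimates, uniqueness and gluing for the regularized flow. -/

section RegularizedFlow

variable {H : Type*} [NormedAddCommGroup H] [InnerProductSpace ℝ H]

/-- If the norm of a differentiable path can only meet the barrier `B` while growing slower than
`B`, then it stays below `B`. -/
theorem norm_le_of_inner_deriv_lt {x x' : ℝ → H} {a b : ℝ} {B B' : ℝ → ℝ}
    (hx : ∀ t ∈ Icc a b, HasDerivWithinAt x (x' t) (Icc a b) t)
    (hBpos : ∀ t ∈ Icc a b, 0 < B t) (hB : ContinuousOn B (Icc a b))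
    (hB' : ∀ t ∈ Ico a b, HasDerivWithinAt B (B' t) (Ici t) t) (ha : ‖x a‖ ≤ B a)
    (bound : ∀ t ∈ Ico a b, ‖x t‖ = B t → inner ℝ (x t) (x' t) < B t * B' t) :
    ∀ t ∈ Icc a b, ‖x t‖ ≤ B t := by
  intro t ht
  -- The squared norm is differentiable even where the path vanishes.
  have key := image_le_of_deriv_right_lt_deriv_boundary' (f := fun t => ‖x t‖ ^ 2)
    (f' := fun t => 2 * inner ℝ (x t) (x' t)) (a := a) (b := b)
    (B := fun t => B t ^ 2) (B' := fun t => 2 * (B t * B' t))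
    (fun s hs => (hx s hs).norm_sq.continuousWithinAt)
    (fun s hs => ((hx s (Ico_subset_Icc_self hs)).mono_of_mem_nhdsWithin
      (Icc_mem_nhdsGE_of_mem hs)).norm_sq)
    (pow_le_pow_left₀ (norm_nonneg _) ha 2) (hB.pow 2)
    (fun s hs => by
      convert! (hB' s hs).pow 2 using 1
      ring)
    (fun s hs h => by
      have h1 : ‖x s‖ = B s :=
        (pow_left_inj₀ (norm_nonneg _) (hBpos s (Ico_subset_Icc_self hs)).le two_ne_zero).1 h
      linarith [bound s hs h1]) ht
  exact (pow_le_pow_iff_left₀ (norm_nonneg _) (hBpos t ht).le two_ne_zero).1 key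

/-- The vector field of the regularized flow. -/
abbrev regularizedField (F : H → H) (ε : ℝ → ℝ) : ℝ → H → H := fun t x => -F x - ε t • x

/-- `u` solves `u' = Φ (t, u)` on `[0, T]` with values in `D` and `u 0 = u₀`. -/
def IsSolutionUpTo (Φ : ℝ → H → H) (D : Set H) (u₀ : H) (T : ℝ) (u : ℝ → H) : Prop :=
  u 0 = u₀ ∧ ∀ t ∈ Icc 0 T, u t ∈ D ∧ HasDerivWithinAt u (Φ t (u t)) (Icc 0 T) t

theorem IsSolutionUpTo.mono {Φ : ℝ → H → H} {D : Set H} {u₀ : H} {S T : ℝ} {u : ℝ → H}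
    (h : IsSolutionUpTo Φ D u₀ T u) (hST : S ≤ T) : IsSolutionUpTo Φ D u₀ S u :=
  ⟨h.1, fun t ht => ⟨(h.2 t ⟨ht.1, ht.2.trans hST⟩).1,
    (h.2 t ⟨ht.1, ht.2.trans hST⟩).2.mono (Icc_subset_Icc_right hST)⟩⟩

theorem IsSolutionUpTo.congr {Φ : ℝ → H → H} {D : Set H} {u₀ : H} {T : ℝ} {u v : ℝ → H}
    (h : IsSolutionUpTo Φ D u₀ T u) (hT : 0 ≤ T) (huv : EqOn v u (Icc 0 T)) :
    IsSolutionUpTo Φ D u₀ T v := by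
  refine ⟨(huv ⟨le_rfl, hT⟩).trans h.1, fun t ht => ?_⟩
  rw [huv ht]
  exact ⟨(h.2 t ht).1, (h.2 t ht).2.congr_of_mem (fun s hs => huv hs) ht⟩

theorem IsGlobalSolution.isSolutionUpTo {Φ : ℝ → H → H} {D : Set H} {u₀ : H} {u : ℝ → H}
    (h : IsGlobalSolution Φ D u₀ u) (T : ℝ) : IsSolutionUpTo Φ D u₀ T u :=
  ⟨h.1, fun t ht => ⟨(h.2 t ht.1).1, (h.2 t ht.1).2.mono Icc_subset_Ici_self⟩⟩

theorem isGlobalSolution_of_forall {Φ : ℝ → H → H} {D : Set H} {u₀ : H} {u : ℝ → H}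
    (h : ∀ T, 0 ≤ T → IsSolutionUpTo Φ D u₀ T u) : IsGlobalSolution Φ D u₀ u := by
  refine ⟨(h 0 le_rfl).1, fun t ht => ?_⟩
  have h1 := (h (t + 1) (by linarith)).2 t ⟨ht, by linarith⟩
  refine ⟨h1.1, h1.2.mono_of_mem_nhdsWithin ?_⟩
  rw [← Ici_inter_Iic]
  exact inter_mem self_mem_nhdsWithin (mem_nhdsWithin_of_mem_nhds (Iic_mem_nhds (by linarith)))

/-- The difference of the values of two regularized fields, tested against the difference of the
arguments. -/
theorem MonotoneOperatorOn.inner_sub_regularized_le {F : H → H} {D : Set H}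
    (hF : MonotoneOperatorOn F D) {x y : H} (hx : x ∈ D) (hy : y ∈ D) (a b : ℝ) :
    inner ℝ (x - y) ((-F x - a • x) - (-F y - b • y)) ≤
      -a * ‖x - y‖ ^ 2 - (a - b) * inner ℝ y (x - y) := by
  have h := hF x hx y hy
  have e : (-F x - a • x) - (-F y - b • y) = -(F x - F y) - (a • (x - y) + (a - b) • y) := by
    module
  rw [e, inner_sub_right, inner_neg_right, inner_add_right, inner_smul_right, inner_smul_right,
    real_inner_self_eq_norm_sq, real_inner_comm y, real_inner_comm (F x - F y)]
  linarith

theorem MonotoneOperatorOn.inner_sub_regularized_le_norm {F : H → H} {D : Set H}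
    (hF : MonotoneOperatorOn F D) {x y : H} (hx : x ∈ D) (hy : y ∈ D) (a b : ℝ) :
    inner ℝ (x - y) ((-F x - a • x) - (-F y - b • y)) ≤
      -a * ‖x - y‖ ^ 2 + |a - b| * (‖y‖ * ‖x - y‖) := by
  have h := hF.inner_sub_regularized_le hx hy a b
  have h1 : |(a - b) * inner ℝ y (x - y)| ≤ |a - b| * (‖y‖ * ‖x - y‖) := by
    rw [abs_mul]
    exact mul_le_mul_of_nonneg_left (abs_real_inner_le_norm _ _) (abs_nonneg _)
  linarith [neg_abs_le ((a - b) * inner ℝ y (x - y))]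

section

variable {F : H → H} {D : Set H} {ε : ℝ → ℝ} {u₀ z : H} {T : ℝ} {u v : ℝ → H}

/-- Monotonicity replaces a Lipschitz constant: at distance `η` the squared distance decreases
strictly, so no level `η > 0` can be crossed. -/
theorem IsSolutionUpTo.eqOn (hF : MonotoneOperatorOn F D) (hε : ∀ t, 0 ≤ t → 0 < ε t)
    (hu : IsSolutionUpTo (regularizedField F ε) D u₀ T u)
    (hv : IsSolutionUpTo (regularizedField F ε) D u₀ T v) : EqOn u v (Icc 0 T) := by
  intro t ht
  have key : ∀ η : ℝ, 0 < η → ‖u t - v t‖ ≤ 0 + η := by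
    intro η hη
    refine (norm_le_of_inner_deriv_lt (x := fun t => u t - v t) (B := fun _ => η)
      (B' := fun _ => 0) (fun s hs => (hu.2 s hs).2.sub (hv.2 s hs).2) (fun _ _ => hη)
      continuousOn_const (fun s _ => hasDerivWithinAt_const _ _ _) ?_ ?_ t ht).trans (by simp)
    · simp [hu.1, hv.1, hη.le]
    · intro s hs h
      have hs' := Ico_subset_Icc_self hs
      have h1 := hF.inner_sub_regularized_le (hu.2 s hs').1 (hv.2 s hs').1 (ε s) (ε s)
      rw [h] at h1
      have := mul_pos (hε s hs.1) (pow_pos hη 2)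
      linarith
  have := le_of_forall_pos_le_add key
  exact sub_eq_zero.1 (norm_le_zero_iff.1 this)

/-- The solutions of the regularized flow stay in a ball around any zero of `F`. -/
theorem IsSolutionUpTo.norm_sub_le (hF : MonotoneOperatorOn F D) (hε : ∀ t, 0 ≤ t → 0 < ε t)
    (hu : IsSolutionUpTo (regularizedField F ε) D u₀ T u) (hz : z ∈ D) (hFz : F z = 0)
    {t : ℝ} (ht : t ∈ Icc 0 T) : ‖u t - z‖ ≤ max ‖u₀ - z‖ ‖z‖ := by
  refine le_of_forall_pos_le_add fun η hη => ?_
  have h0 : 0 < max ‖u₀ - z‖ ‖z‖ + η := add_pos_of_nonneg_of_pos (by positivity) hη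
  refine norm_le_of_inner_deriv_lt (x := fun t => u t - z)
      (x' := fun t => regularizedField F ε t (u t)) (B := fun _ => max ‖u₀ - z‖ ‖z‖ + η)
      (B' := fun _ => 0) (fun s hs => (hu.2 s hs).2.sub_const z) (fun _ _ => h0)
      continuousOn_const (fun s _ => hasDerivWithinAt_const _ _ _) ?_ ?_ t ht
  · simp only [hu.1]
    linarith [le_max_left ‖u₀ - z‖ ‖z‖]
  · intro s hs h
    have hs' := Ico_subset_Icc_self hs
    -- `z` is a rest point for parameter `0`. The remaining drift `ε s * ‖z‖` loses to the
    -- attraction because the radius exceeds `‖z‖`.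
    have h1 := hF.inner_sub_regularized_le_norm (hu.2 s hs').1 hz (ε s) 0
    have hεs := hε s hs.1
    simp only [hFz, neg_zero, zero_smul, sub_zero, abs_of_pos hεs] at h1
    rw [h] at h1
    have h2 : 0 < ε s * ((max ‖u₀ - z‖ ‖z‖ + η) * ((max ‖u₀ - z‖ ‖z‖ + η) - ‖z‖)) :=
      mul_pos hεs (mul_pos h0 (by linarith [le_max_right ‖u₀ - z‖ ‖z‖]))
    calc _ ≤ _ := h1
      _ < _ := by nlinarith

theorem IsSolutionUpTo.hasDerivWithinAt_shift {Φ : ℝ → H → H} {h : ℝ}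
    (hu : IsSolutionUpTo Φ D u₀ T u) (hh : 0 ≤ h) {t : ℝ} (ht : t ∈ Icc 0 (T - h)) :
    HasDerivWithinAt (fun s => u (s + h) - u s) (Φ (t + h) (u (t + h)) - Φ t (u t))
      (Icc 0 (T - h)) t := by
  have h1 := (hu.2 (t + h) ⟨by linarith [ht.1], by linarith [ht.2]⟩).2
  have h2 := ((hu.2 t ⟨ht.1, by linarith [ht.2]⟩).2).mono
    (Icc_subset_Icc_right (by linarith : T - h ≤ T))
  have h3 := HasDerivWithinAt.scomp t (t' := Icc 0 T) (s := Icc 0 (T - h)) (h := fun s => s + h)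
    h1 ((hasDerivWithinAt_id t _).add_const h)
    (fun s hs => ⟨by linarith [hs.1], by linarith [hs.2]⟩)
  rw [one_smul] at h3
  exact h3.sub h2

/-- Equicontinuity of the solutions: the modulus of continuity at `0` controls the one at `t`, up to
the oscillation `η` of the regularization parameter. -/
theorem IsSolutionUpTo.norm_shift_sub_le (hF : MonotoneOperatorOn F D)
    (hε : ∀ t, 0 ≤ t → 0 < ε t) (hu : IsSolutionUpTo (regularizedField F ε) D u₀ T u)
    {C η h : ℝ} (hC : ∀ t ∈ Icc 0 T, ‖u t‖ ≤ C) (hη : 0 < η) (hh : 0 ≤ h)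
    (hosc : ∀ t ∈ Icc 0 (T - h), |ε (t + h) - ε t| ≤ η) (h0 : ‖u h - u 0‖ ≤ η) :
    ∀ t ∈ Icc 0 (T - h), ‖u (t + h) - u t‖ ≤ η + C * η * t := by
  intro t ht
  have hC0 : 0 ≤ C := (norm_nonneg _).trans (hC t ⟨ht.1, by linarith [ht.2]⟩)
  have hB : ∀ s, HasDerivAt (fun s => η + C * η * s) (C * η) s := fun s => by
    simpa using ((hasDerivAt_id s).const_mul (C * η)).const_add η
  -- The slope `C * η` bounds the forcing `|ε (s + h) - ε s| * ‖u s‖`; the attraction term makes the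
  -- inequality strict.
  refine norm_le_of_inner_deriv_lt (x := fun s => u (s + h) - u s) (B := fun s => η + C * η * s)
    (B' := fun _ => C * η) (fun s hs => hu.hasDerivWithinAt_shift hh hs)
    (fun s hs => ?_) (by fun_prop) (fun s _ => (hB s).hasDerivWithinAt) (by simpa using h0) ?_ t ht
  · have := hs.1
    positivity
  · intro s hs he
    have hs' := Ico_subset_Icc_self hs
    have hsT : s ∈ Icc 0 T := ⟨hs.1, by linarith [hs'.2]⟩
    have hshT : s + h ∈ Icc 0 T := ⟨by linarith [hs.1], by linarith [hs'.2]⟩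
    have h1 := hF.inner_sub_regularized_le_norm (hu.2 _ hshT).1 (hu.2 s hsT).1 (ε (s + h)) (ε s)
    rw [he] at h1
    have hp : 0 < η + C * η * s := by
      have := hs.1
      positivity
    have h2 : |ε (s + h) - ε s| * (‖u s‖ * (η + C * η * s)) ≤ η * (C * (η + C * η * s)) :=
      mul_le_mul (hosc s hs') (mul_le_mul_of_nonneg_right (hC s hsT) hp.le) (by positivity) hη.le
    have h3 := mul_pos (hε _ hshT.1) (pow_pos hp 2)
    calc _ ≤ _ := h1
      _ < _ := by nlinarith

end

/-- Solutions on compact intervals, one for each endpoint in `J`, are restrictions of one path. -/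
theorem exists_glue {F : H → H} {D : Set H} {ε : ℝ → ℝ} {u₀ : H} {J : Set ℝ}
    (hF : MonotoneOperatorOn F D) (hε : ∀ t, 0 ≤ t → 0 < ε t)
    (hJ : ∀ T ∈ J, ∀ t ∈ Icc 0 T, t ∈ J)
    (h : ∀ T ∈ J, 0 ≤ T → ∃ u, IsSolutionUpTo (regularizedField F ε) D u₀ T u) :
    ∃ u, ∀ T ∈ J, 0 ≤ T → IsSolutionUpTo (regularizedField F ε) D u₀ T u := by
  classical
  choose! s hs using h
  -- The value at `t` is read off the solution on `[0, t]`; uniqueness identifies it with that of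
  -- any longer solution.
  refine ⟨fun t => s t t, fun T hT h0 => (hs T hT h0).congr h0 fun t ht => ?_⟩
  exact (hs t (hJ T hT t ht) ht.1).eqOn hF hε ((hs T hT h0).mono ht.2) ⟨ht.1, le_rfl⟩

/-- Concatenation of a solution with a continuation. -/
theorem IsSolutionUpTo.concat {Φ : ℝ → H → H} {D : Set H} {u₀ : H} {S T : ℝ} {u v : ℝ → H}
    (hu : IsSolutionUpTo Φ D u₀ S u) (hS : 0 ≤ S) (hST : S ≤ T) (hv0 : v S = u S)
    (hv : ∀ t ∈ Icc S T, v t ∈ D ∧ HasDerivWithinAt v (Φ t (v t)) (Icc S T) t) :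
    ∃ w, IsSolutionUpTo Φ D u₀ T w := by
  classical
  set w : ℝ → H := fun t => if t ≤ S then u t else v t with hw
  have hwu : ∀ t ∈ Icc 0 S, w t = u t := fun t ht => if_pos ht.2
  have hwv : ∀ t ∈ Icc S T, w t = v t := fun t ht => by
    rcases ht.1.eq_or_lt with rfl | h
    · simp [hw, hv0]
    · exact if_neg (not_le.2 h)
  have dl : ∀ t ∈ Icc 0 S, HasDerivWithinAt w (Φ t (w t)) (Icc 0 S) t := fun t ht => by
    rw [hwu t ht]
    exact (hu.2 t ht).2.congr_of_mem hwu ht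
  have dr : ∀ t ∈ Icc S T, HasDerivWithinAt w (Φ t (w t)) (Icc S T) t := fun t ht => by
    rw [hwv t ht]
    exact (hv t ht).2.congr_of_mem hwv ht
  refine ⟨w, (hwu 0 ⟨le_rfl, hS⟩).trans hu.1, fun t ht => ?_⟩
  rw [← Icc_union_Icc_eq_Icc hS hST]
  -- Off the junction, `t` is outside the closure of one interval, so the derivative within it is
  -- vacuous; at `S` the one-sided derivatives agree.
  rcases lt_trichotomy t S with h | h | h
  · have ht' : t ∈ Icc 0 S := ⟨ht.1, h.le⟩
    refine ⟨hwu t ht' ▸ (hu.2 t ht').1, (dl t ht').union ?_⟩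
    exact HasFDerivWithinAt.of_notMem_closure (by simpa [isClosed_Icc.closure_eq] using fun h' => absurd h' (not_le.2 h))
  · subst h
    have ht' : t ∈ Icc 0 t := ⟨ht.1, le_rfl⟩
    exact ⟨hwu t ht' ▸ (hu.2 t ht').1, (dl t ht').union (dr t ⟨le_rfl, hST⟩)⟩
  · have ht' : t ∈ Icc S T := ⟨h.le, ht.2⟩
    refine ⟨hwv t ht' ▸ (hv t ht').1, HasDerivWithinAt.union ?_ (dr t ht')⟩
    exact HasFDerivWithinAt.of_notMem_closure (by simpa [isClosed_Icc.closure_eq] using fun _ => h)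

end RegularizedFlow

/-! ### Local solvability, continuation and global existence. -/

section RegularizedFlowExistence

variable {H : Type*} [NormedAddCommGroup H]

theorem LocallyLipschitzOn.exists_lipschitzOnWith_closedBall {F : H → H} {U D : Set H}
    (hF : LocallyLipschitzOn D F) (hU : IsOpen U) (hUD : U ⊆ D) {x : H} (hx : x ∈ U) :
    ∃ (K : NNReal) (a : ℝ), 0 < a ∧ closedBall x a ⊆ U ∧ LipschitzOnWith K F (closedBall x a) := by
  obtain ⟨K, t, ht, hK⟩ := hF (hUD hx)
  have hD : D ∈ 𝓝 x := mem_of_superset (hU.mem_nhds hx) hUD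
  rw [nhdsWithin_eq_nhds.2 hD] at ht
  obtain ⟨a, ha, h⟩ := nhds_basis_closedBall.mem_iff.1 (inter_mem (hU.mem_nhds hx) ht)
  exact ⟨K, a, ha, h.trans inter_subset_left, hK.mono (h.trans inter_subset_right)⟩

theorem LocallyLipschitzOn.continuousAt_of_isOpen {F : H → H} {U D : Set H}
    (hF : LocallyLipschitzOn D F) (hU : IsOpen U) (hUD : U ⊆ D) {x : H} (hx : x ∈ U) :
    ContinuousAt F x := by
  obtain ⟨K, a, ha, -, hK⟩ := hF.exists_lipschitzOnWith_closedBall hU hUD hx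
  exact hK.continuousOn.continuousAt (closedBall_mem_nhds x ha)

variable [InnerProductSpace ℝ H] [CompleteSpace H]

/-- Local solvability, forward in time, of the regularized flow. -/
theorem exists_local_solution {F : H → H} {U D : Set H} {ε : ℝ → ℝ} (hU : IsOpen U)
    (hUD : U ⊆ D) (hF : LocallyLipschitzOn D F) (hεc : ContinuousOn ε (Ici 0)) {S : ℝ}
    (hS : 0 ≤ S) {x : H} (hx : x ∈ U) :
    ∃ T, S < T ∧ ∃ v : ℝ → H, v S = x ∧ ∀ t ∈ Icc S T,
      v t ∈ U ∧ HasDerivWithinAt v (regularizedField F ε t (v t)) (Icc S T) t := by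
  obtain ⟨K, a, ha, haU, hK⟩ := hF.exists_lipschitzOnWith_closedBall hU hUD hx
  have hεc' : ContinuousOn ε (Icc S (S + 1)) :=
    hεc.mono fun t ht => hS.trans ht.1
  obtain ⟨E, hE⟩ := isCompact_Icc.exists_bound_of_continuousOn hεc'
  have hE0 : 0 ≤ E := (norm_nonneg _).trans (hE S ⟨le_rfl, by linarith⟩)
  set L : ℝ := ‖F x‖ + K * a + E * (‖x‖ + a) with hL
  have hL0 : 0 ≤ L := by positivity
  -- `L` bounds the speed on the ball of radius `a`, so a path cannot leave it within time `δ`; `L +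
  -- 1` guards against `L = 0`.
  set δ : ℝ := min 1 (a / (L + 1)) with hδ
  have hδ0 : 0 < δ := lt_min one_pos (by positivity)
  have hLδ : L * δ ≤ a := by
    have h1 : δ ≤ a / (L + 1) := min_le_right _ _
    calc L * δ ≤ (L + 1) * (a / (L + 1)) := by gcongr; linarith
      _ = a := by field_simp
  have hsub : Icc S (S + δ) ⊆ Icc S (S + 1) := 
    Icc_subset_Icc_right (by linarith [min_le_left 1 (a / (L + 1))])
  have hPL : IsPicardLindelof (regularizedField F ε) (tmin := S) (tmax := S + δ)
      ⟨S, le_rfl, by linarith⟩ x ⟨a, ha.le⟩ 0 ⟨L, hL0⟩ (K + E.toNNReal) := by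
    refine ⟨fun t ht => ?_, fun y hy => ?_, fun t ht y hy => ?_, ?_⟩
    · refine LipschitzOnWith.of_dist_le_mul fun y hy w hw => ?_
      have h1 := hK.dist_le_mul y hy w hw
      have h2 := hE t (hsub ht)
      rw [dist_eq_norm] at h1 ⊢
      have e : regularizedField F ε t y - regularizedField F ε t w =
        -(F y - F w) - ε t • (y - w) := by simp only [regularizedField]; module
      rw [e]
      refine (_root_.norm_sub_le _ _).trans ?_
      rw [norm_neg, norm_smul, NNReal.coe_add, Real.coe_toNNReal _ hE0, add_mul, dist_eq_norm]
      rw [dist_eq_norm] at h1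
      exact add_le_add h1 (mul_le_mul_of_nonneg_right h2 (norm_nonneg _))
    · exact continuousOn_const.sub ((hεc'.mono hsub).smul continuousOn_const)
    · have h1 := hK.dist_le_mul y hy x (mem_closedBall_self ha.le)
      have h2 := hE t (hsub ht)
      have hy' : dist y x ≤ a := hy
      have h3 : ‖F y‖ ≤ ‖F x‖ + K * a := by
        have h4 := norm_le_norm_add_norm_sub' (F y) (F x)
        rw [dist_eq_norm] at h1
        have : (K : ℝ) * dist y x ≤ K * a := by gcongr
        linarith
      have h5 : ‖y‖ ≤ ‖x‖ + a := by
        have h4 := norm_le_norm_add_norm_sub' y x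
        rw [dist_eq_norm] at hy'
        linarith
      refine (_root_.norm_sub_le _ _).trans ?_
      rw [norm_neg, norm_smul]
      exact add_le_add h3 (mul_le_mul h2 h5 (norm_nonneg _) hE0)
    · simp only [add_sub_cancel_left, sub_self, NNReal.coe_zero, sub_zero]
      rw [max_eq_left hδ0.le]
      exact hLδ
  obtain ⟨v, hv0, hv⟩ := hPL.exists_eq_forall_mem_Icc_hasDerivWithinAt₀
  simp only at hv0
  have hvc : ContinuousWithinAt v (Icc S (S + δ)) S :=
    (hv S ⟨le_rfl, by linarith⟩).continuousWithinAt
  have hvU : ∀ᶠ t in 𝓝[≥] S, v t ∈ U := by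
    rw [← nhdsWithin_Icc_eq_nhdsGE (by linarith : S < S + δ)]
    exact hvc (hU.mem_nhds (hv0 ▸ hx))
  obtain ⟨T, hT, hTU⟩ := (mem_nhdsGE_iff_exists_Icc_subset).1 hvU
  have hT' : S < T := hT
  refine ⟨min T (S + δ), lt_min hT' (by linarith), v, hv0, fun t ht => ⟨?_, ?_⟩⟩
  · exact hTU ⟨ht.1, ht.2.trans (min_le_left _ _)⟩
  · exact (hv t ⟨ht.1, ht.2.trans (min_le_right _ _)⟩).mono
      (Icc_subset_Icc_right (min_le_right _ _))

/-- A solution on `[0, S)` that stays in a closed subset of an open set in `D` extends to `S`. -/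
theorem exists_solution_at_endpoint {F : H → H} {U D : Set H} {ε : ℝ → ℝ} {u₀ z : H}
    (hU : IsOpen U) (hUD : U ⊆ D) (hF : MonotoneOperatorOn F D) (hFl : LocallyLipschitzOn D F)
    (hz : z ∈ D) (hFz : F z = 0) (hK : closedBall z (max ‖u₀ - z‖ ‖z‖) ⊆ U)
    (hε : ∀ t, 0 ≤ t → 0 < ε t) (hεc : ContinuousOn ε (Ici 0)) {S : ℝ} (hS : 0 < S) {u : ℝ → H}
    (hu : ∀ T ∈ Iio S, 0 ≤ T → IsSolutionUpTo (regularizedField F ε) D u₀ T u) :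
    ∃ w, IsSolutionUpTo (regularizedField F ε) D u₀ S w := by
  have huK : ∀ t ∈ Ico 0 S, u t ∈ closedBall z (max ‖u₀ - z‖ ‖z‖) := fun t ht => by
    rw [mem_closedBall, dist_eq_norm]
    exact (hu t ht.2 ht.1).norm_sub_le hF hε hz hFz ⟨ht.1, le_rfl⟩
  set C : ℝ := ‖z‖ + max ‖u₀ - z‖ ‖z‖ with hC
  have hC0 : 0 ≤ C := by positivity
  have huC : ∀ t ∈ Ico 0 S, ‖u t‖ ≤ C := fun t ht => by
    have h1 := huK t ht
    rw [mem_closedBall, dist_eq_norm] at h1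
    linarith [norm_le_norm_add_norm_sub' (u t) z]
  have hder : ∀ t ∈ Ioo 0 S, HasDerivAt u (regularizedField F ε t (u t)) t := fun t ht => by
    have h1 : (t + S) / 2 < S := by linarith [ht.2]
    exact ((hu _ h1 (by linarith [ht.1, hS])).2 t ⟨ht.1.le, by linarith [ht.2]⟩).2.hasDerivAt
      (Icc_mem_nhds ht.1 (by linarith [ht.2]))
  -- the modulus of continuity at `0` propagates, so `u` is Cauchy at `S`
  have hcauchy : Cauchy (map u (𝓝[<] S)) := by
    rw [Metric.cauchy_iff]
    refine ⟨inferInstance, fun r hr => ?_⟩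
    -- The shift estimate is at most `η * (1 + C * S) = r / 2` on `[0, S]`.
    set η : ℝ := r / (2 * (1 + C * S)) with hη
    have hη0 : 0 < η := by positivity
    have hηr : η * (1 + C * S) < r := by
      rw [hη]; field_simp; linarith
    have huc : UniformContinuousOn ε (Icc 0 S) :=
      isCompact_Icc.uniformContinuousOn_of_continuous (hεc.mono Icc_subset_Ici_self)
    obtain ⟨d₁, hd₁, hosc⟩ := Metric.uniformContinuousOn_iff.1 huc η hη0
    have hc0 : ContinuousWithinAt u (Icc 0 (S / 2)) 0 :=
      ((hu (S / 2) (by simp [hS]) (by positivity)).2 0 ⟨le_rfl, by positivity⟩).2.continuousWithinAt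
    obtain ⟨d₂, hd₂, hc⟩ := Metric.continuousWithinAt_iff.1 hc0 η hη0
    set d := min (min d₁ d₂) (S / 2) with hd
    have hd0 : 0 < d := by positivity
    have hdd₁ : d ≤ d₁ := (min_le_left _ _).trans (min_le_left _ _)
    have hdd₂ : d ≤ d₂ := (min_le_left _ _).trans (min_le_right _ _)
    have hdS : d ≤ S / 2 := min_le_right _ _
    have key : ∀ s ∈ Ioo (S - d) S, ∀ t ∈ Ioo (S - d) S, s ≤ t → ‖u t - u s‖ < r := by
      intro s hs t ht hst
      have hh : 0 ≤ t - s := by linarith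
      have hhd : t - s < d := by linarith [hs.1, ht.2]
      have hs0 : 0 ≤ s := by linarith [hs.1]
      have h1 := (hu t ht.2 (hs0.trans hst)).norm_shift_sub_le hF hε (C := C) (η := η) (h := t - s)
        (fun q hq => huC q ⟨hq.1, hq.2.trans_lt ht.2⟩) hη0 hh
        (fun q hq => by
          have h2 := hosc (q + (t - s)) ⟨by linarith [hq.1], by linarith [hq.2, ht.2]⟩ q
            ⟨hq.1, by linarith [hq.2, ht.2]⟩ (by
              rw [Real.dist_eq, add_sub_cancel_left, abs_of_nonneg hh]; linarith)
          rw [Real.dist_eq] at h2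
          exact h2.le)
        (by
          have h2 := hc (x := t - s) ⟨hh, by linarith⟩
            (by rw [Real.dist_eq, sub_zero, abs_of_nonneg hh]; linarith)
          rw [dist_eq_norm] at h2
          exact h2.le) s ⟨hs0, by linarith⟩
      rw [add_sub_cancel] at h1
      have h3 : C * η * s ≤ C * η * S := by
        have := hs.2.le
        gcongr
      calc _ ≤ _ := h1
        _ ≤ η * (1 + C * S) := by linarith
        _ < r := hηr
    refine ⟨u '' Ioo (S - d) S, image_mem_map (Ioo_mem_nhdsLT (by linarith)), ?_⟩
    rintro _ ⟨s, hs, rfl⟩ _ ⟨t, ht, rfl⟩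
    rcases le_total s t with h | h
    · rw [dist_comm, dist_eq_norm]
      exact key s hs t ht h
    · rw [dist_eq_norm]
      exact key t ht s hs h
  obtain ⟨x, hx⟩ := cauchy_map_iff_exists_tendsto.1 hcauchy
  have hxK : x ∈ closedBall z (max ‖u₀ - z‖ ‖z‖) :=
    isClosed_closedBall.mem_of_tendsto hx (mem_of_superset (Ioo_mem_nhdsLT hS) fun t ht =>
      huK t ⟨ht.1.le, ht.2⟩)
  classical
  set w : ℝ → H := Function.update u S x with hw
  have hwS : w S = x := Function.update_self _ _ _
  have hwu : ∀ t, t < S → w t = u t := fun t ht => Function.update_of_ne ht.ne _ _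
  refine ⟨w, (hwu 0 hS).trans (hu 0 hS le_rfl).1, fun t ht => ?_⟩
  rcases ht.2.eq_or_lt with rfl | h
  · rw [hwS]
    refine ⟨hUD (hK hxK), HasDerivWithinAt.mono ?_ Icc_subset_Iic_self⟩
    have heq : ∀ᶠ s in 𝓝[<] t, w s = u s :=
      eventually_nhdsWithin_of_forall fun s hs => hwu s hs
    have hwd : ∀ s ∈ Ioo 0 t, HasDerivAt w (regularizedField F ε s (u s)) s := fun s hs =>
      (hder s hs).congr_of_eventuallyEq (by
        filter_upwards [Iio_mem_nhds hs.2] with q hq using hwu q hq)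
    -- The derivative at the endpoint is the limit of the interior derivatives, which exists as `F`
    -- and `ε` are continuous there.
    refine hasDerivWithinAt_Iic_of_tendsto_deriv (s := Ioo 0 t)
      (fun s hs => (hwd s hs).differentiableAt.differentiableWithinAt) ?_
      (Ioo_mem_nhdsLT hS) ?_
    · have : Tendsto w (𝓝[<] t) (𝓝 (w t)) := by
        rw [hwS]
        exact hx.congr' (heq.mono fun s hs => hs.symm)
      exact this.mono_left (nhdsWithin_mono _ Ioo_subset_Iio_self)
    · have hFx := (hFl.continuousAt_of_isOpen hU hUD (hK hxK)).tendsto.comp hx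
      have hεt : Tendsto ε (𝓝[<] t) (𝓝 (ε t)) :=
        (hεc.continuousAt (Ici_mem_nhds hS)).tendsto.mono_left nhdsWithin_le_nhds
      refine (hFx.neg.sub (hεt.smul hx)).congr' ?_
      filter_upwards [Ioo_mem_nhdsLT hS] with s hs
      exact (hwd s hs).deriv.symm
  · have h1 : (t + S) / 2 < S := by linarith
    have h2 : t < (t + S) / 2 := by linarith
    have h0 : 0 ≤ (t + S) / 2 := by linarith [ht.1]
    have h3 := (((hu _ h1 h0).congr (v := w) h0 fun s hs => hwu s (hs.2.trans_lt h1)).2 t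
      ⟨ht.1, h2.le⟩)
    refine ⟨h3.1, h3.2.mono_of_mem_nhdsWithin ?_⟩
    filter_upwards [self_mem_nhdsWithin, mem_nhdsWithin_of_mem_nhds (Iic_mem_nhds h2)] with s h4 h5
    exact ⟨h4.1, h5⟩

/-- A finite supremum of existence times would be attained by endpoint extension, then exceeded by a
local solution, since the a priori ball lies in `U`. -/
theorem exists_isGlobalSolution_regularized {F : H → H} {U D : Set H} {ε : ℝ → ℝ} {u₀ z : H}
    (hU : IsOpen U) (hUD : U ⊆ D) (hF : MonotoneOperatorOn F D) (hFl : LocallyLipschitzOn D F)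
    (hz : z ∈ D) (hFz : F z = 0) (hK : closedBall z (max ‖u₀ - z‖ ‖z‖) ⊆ U)
    (hε : ∀ t, 0 ≤ t → 0 < ε t) (hεc : ContinuousOn ε (Ici 0)) :
    ∃ u, IsGlobalSolution (regularizedField F ε) D u₀ u := by
  have hu₀ : u₀ ∈ U := hK (by rw [mem_closedBall, dist_eq_norm]; exact le_max_left _ _)
  have h0 : ∃ w, IsSolutionUpTo (regularizedField F ε) D u₀ 0 w :=
    ⟨fun _ => u₀, rfl, fun t _ => ⟨hUD hu₀, by
      rw [Icc_self]
      exact HasFDerivWithinAt.of_subsingleton subsingleton_singleton⟩⟩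
  have hall : ∀ T, 0 ≤ T → ∃ w, IsSolutionUpTo (regularizedField F ε) D u₀ T w := by
    by_contra! hcon
    obtain ⟨T₁, hT₁, hno⟩ := hcon
    set A : Set ℝ := {T | 0 ≤ T ∧ ∃ w, IsSolutionUpTo (regularizedField F ε) D u₀ T w} with hA
    have hA0 : (0 : ℝ) ∈ A := ⟨le_rfl, h0⟩
    have hAb : BddAbove A := ⟨T₁, fun T hT => by
      by_contra! h
      obtain ⟨w, hw⟩ := hT.2
      exact hno w (hw.mono h.le)⟩
    set S := sSup A with hS
    have hS0 : 0 ≤ S := le_csSup hAb hA0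
    have hSA : ∃ w, IsSolutionUpTo (regularizedField F ε) D u₀ S w := by
      rcases hS0.eq_or_lt with h | h
      · rw [← h]
        exact h0
      · obtain ⟨u, hu⟩ := exists_glue (J := Iio S) (u₀ := u₀) hF hε
          (fun T hT t ht => ht.2.trans_lt hT) fun T hT _ => by
            obtain ⟨T', ⟨_, w, hw⟩, hTT'⟩ := exists_lt_of_lt_csSup ⟨0, hA0⟩ hT
            exact ⟨w, hw.mono hTT'.le⟩
        exact exists_solution_at_endpoint hU hUD hF hFl hz hFz hK hε hεc h hu
    obtain ⟨u, hu⟩ := hSA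
    have huS : u S ∈ U := hK (by
      rw [mem_closedBall, dist_eq_norm]
      exact hu.norm_sub_le hF hε hz hFz ⟨hS0, le_rfl⟩)
    obtain ⟨T, hT, v, hv0, hv⟩ := exists_local_solution hU hUD hFl hεc hS0 huS
    obtain ⟨w, hw⟩ := hu.concat hS0 hT.le hv0 fun t ht => ⟨hUD (hv t ht).1, (hv t ht).2⟩
    exact absurd (le_csSup hAb ⟨hS0.trans hT.le, w, hw⟩) (not_le.2 hT)
  obtain ⟨u, hu⟩ := exists_glue (J := univ) (u₀ := u₀) hF hε (fun _ _ _ _ => mem_univ _)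
    fun T _ hT => hall T hT
  exact ⟨u, isGlobalSolution_of_forall fun T hT => hu T (mem_univ _) hT⟩

end RegularizedFlowExistence

/-! ### Zeros of `F + a` and their limit as `a → 0`. -/

section RegularizedZeros

variable {H : Type*} [NormedAddCommGroup H] [InnerProductSpace ℝ H]

/-- The regularized flow with a constant parameter `a` converges to a zero of `F + a`. -/
theorem exists_regularized_zero [CompleteSpace H] {F : H → H} {U D : Set H} {u₀ z : H}
    (hU : IsOpen U) (hUD : U ⊆ D) (hF : MonotoneOperatorOn F D) (hFl : LocallyLipschitzOn D F)
    (hz : z ∈ D) (hFz : F z = 0) (hK : closedBall z (max ‖u₀ - z‖ ‖z‖) ⊆ U) {a : ℝ} (ha : 0 < a) :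
    ∃ w ∈ closedBall z (max ‖u₀ - z‖ ‖z‖), F w + a • w = 0 := by
  obtain ⟨u, hu⟩ := exists_isGlobalSolution_regularized (ε := fun _ => a) hU hUD hF hFl hz hFz hK
    (fun _ _ => ha) continuousOn_const
  set ρ := max ‖u₀ - z‖ ‖z‖ with hρ
  have hρ0 : 0 ≤ ρ := (norm_nonneg _).trans (le_max_right _ _)
  have huK : ∀ t, 0 ≤ t → ‖u t - z‖ ≤ ρ := fun t ht =>
    (hu.isSolutionUpTo t).norm_sub_le hF (fun _ _ => ha) hz hFz ⟨ht, le_rfl⟩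
  -- The true decay rate is `a`; half of it leaves strict inequality. The factor exceeds the
  -- diameter bound `2 * ρ` and is positive even if `ρ = 0`.
  set B : ℝ → ℝ := fun t => (2 * ρ + 1) * Real.exp (-(a / 2) * t) with hB
  have hBd : ∀ t, HasDerivAt B (-(a / 2) * B t) t := fun t => by
    convert! (((hasDerivAt_id t).const_mul (-(a / 2))).exp).const_mul (2 * ρ + 1) using 1
    simp only [hB, id]
    ring
  have hBpos : ∀ t, 0 < B t := fun t => by positivity
  have hshift : ∀ h, 0 ≤ h → ∀ t, 0 ≤ t → ‖u (t + h) - u t‖ ≤ B t := by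
    intro h hh t ht
    have hsol := hu.isSolutionUpTo (t + h)
    refine norm_le_of_inner_deriv_lt (x := fun s => u (s + h) - u s) (B := B)
      (B' := fun t => -(a / 2) * B t) (a := 0) (b := t + h - h)
      (fun s hs => hsol.hasDerivWithinAt_shift hh hs) (fun s _ => hBpos s)
      (fun s _ => (hBd s).continuousAt.continuousWithinAt) (fun s _ => (hBd s).hasDerivWithinAt)
      ?_ ?_ t ⟨ht, by simp⟩
    · have e : u (0 + h) - u 0 = (u h - z) - (u 0 - z) := by simp
      simp only [e, hB, mul_zero, Real.exp_zero, mul_one]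
      linarith [_root_.norm_sub_le (u h - z) (u 0 - z), huK h hh, huK 0 le_rfl]
    · intro s hs he
      have h1 := hF.inner_sub_regularized_le (hu.2 (s + h) (by linarith [hs.1])).1
        (hu.2 s hs.1).1 a a
      rw [he] at h1
      have h2 := mul_pos ha (pow_pos (hBpos s) 2)
      calc _ ≤ _ := h1
        _ < _ := by nlinarith
  have hB0 : Tendsto B atTop (𝓝 0) := by
    have h1 : Tendsto (fun t : ℝ => -(a / 2) * t) atTop atBot :=
      tendsto_id.const_mul_atTop_of_neg (by linarith)
    have h2 := (Real.tendsto_exp_atBot.comp h1).const_mul (2 * ρ + 1)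
    rwa [mul_zero] at h2
  have hcauchy : Cauchy (map u atTop) := by
    rw [Metric.cauchy_iff]
    refine ⟨inferInstance, fun r hr => ?_⟩
    obtain ⟨N, hN⟩ := eventually_atTop.1
      ((hB0.eventually (gt_mem_nhds (half_pos hr))).and (eventually_ge_atTop 0))
    have hN0 : 0 ≤ N := (hN N le_rfl).2
    have key : ∀ t ∈ Ici N, dist (u t) (u N) < r / 2 := fun t ht => by
      have h1 := hshift (t - N) (sub_nonneg.2 ht) N hN0
      rw [add_sub_cancel] at h1
      rw [dist_eq_norm]
      exact h1.trans_lt (hN N le_rfl).1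
    refine ⟨u '' Ici N, image_mem_map (Ici_mem_atTop N), ?_⟩
    rintro _ ⟨s, hs, rfl⟩ _ ⟨t, ht, rfl⟩
    linarith [dist_triangle_right (u s) (u t) (u N), key s hs, key t ht]
  obtain ⟨w, hw⟩ := cauchy_map_iff_exists_tendsto.1 hcauchy
  have hwK : w ∈ closedBall z ρ := isClosed_closedBall.mem_of_tendsto hw <| by
    filter_upwards [eventually_ge_atTop 0] with t ht
    rw [mem_closedBall, dist_eq_norm]
    exact huK t ht
  refine ⟨w, hwK, ?_⟩
  -- the velocity converges, and its limit is `0` since `u` converges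
  have hvel : Tendsto (fun t => -F (u t) - a • u t) atTop (𝓝 (-F w - a • w)) :=
    (((hFl.continuousAt_of_isOpen hU hUD (hK hwK)).tendsto.comp hw).neg).sub (hw.const_smul a)
  have hinc : Tendsto (fun t => u (t + 1) - u t) atTop (𝓝 0) := by
    simpa using (hw.comp (tendsto_atTop_add_const_right atTop (1 : ℝ) tendsto_id)).sub hw
  set c := -F w - a • w with hc
  have hinc' : Tendsto (fun t => u (t + 1) - u t) atTop (𝓝 c) := by
    rw [Metric.tendsto_atTop] at hvel ⊢
    intro r hr
    obtain ⟨N, hN⟩ := hvel (r / 2) (half_pos hr)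
    refine ⟨max N 0, fun t ht => ?_⟩
    have ht0 : 0 ≤ t := (le_max_right _ _).trans ht
    -- Subtracting the linear motion `s • c` leaves velocity at most `r / 2`, so the unit-time
    -- increment is that close to `c`.
    have h1 := norm_image_sub_le_of_norm_deriv_le_segment' (f := fun s => u s - s • c)
      (f' := fun s => (-F (u s) - a • u s) - c) (C := r / 2) (a := t) (b := t + 1)
      (fun s hs => by
        have h2 := ((hu.2 s (ht0.trans hs.1)).2).mono
          (fun q hq => ht0.trans hq.1 : Icc t (t + 1) ⊆ Ici 0)
        have h3 := (hasDerivWithinAt_id s (Icc t (t + 1))).smul_const c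
        rw [one_smul] at h3
        exact h2.sub h3)
      (fun s hs => by
        have h2 := hN s ((le_max_left _ _).trans (ht.trans hs.1))
        rw [dist_eq_norm] at h2
        exact h2.le) (t + 1) ⟨by linarith, le_rfl⟩
    have e : u (t + 1) - (t + 1) • c - (u t - t • c) = (u (t + 1) - u t) - c := by module
    rw [e] at h1
    rw [dist_eq_norm]
    linarith
  have hc0 : c = 0 := tendsto_nhds_unique hinc' hinc
  rw [hc] at hc0
  rw [← neg_eq_zero, ← hc0]
  abel

variable {F : H → H} {D : Set H} {x y : H} {a b : ℝ}

theorem MonotoneOperatorOn.sq_norm_sub_regularized_zeros (hF : MonotoneOperatorOn F D)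
    (hx : x ∈ D) (hy : y ∈ D) (hxa : F x + a • x = 0) (hyb : F y + b • y = 0) :
    a * ‖x - y‖ ^ 2 + (a - b) * inner ℝ y (x - y) ≤ 0 := by
  have h := hF.inner_sub_regularized_le hx hy a b
  have e : (-F x - a • x) - (-F y - b • y) = -(F x + a • x) + (F y + b • y) := by abel
  rw [e, hxa, hyb, neg_zero, add_zero, inner_zero_right] at h
  linarith

/-- Regularized zeros depend Lipschitz continuously on the parameter. -/
theorem MonotoneOperatorOn.norm_sub_regularized_zeros_le (hF : MonotoneOperatorOn F D)
    (hx : x ∈ D) (hy : y ∈ D) (ha : 0 < a) (hxa : F x + a • x = 0) (hyb : F y + b • y = 0) :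
    ‖x - y‖ ≤ |a - b| / a * ‖y‖ := by
  have h := hF.sq_norm_sub_regularized_zeros hx hy hxa hyb
  have h1 : |(a - b) * inner ℝ y (x - y)| ≤ |a - b| * (‖y‖ * ‖x - y‖) := by
    rw [abs_mul]
    exact mul_le_mul_of_nonneg_left (abs_real_inner_le_norm _ _) (abs_nonneg _)
  have h2 := neg_abs_le ((a - b) * inner ℝ y (x - y))
  rcases (norm_nonneg (x - y)).eq_or_lt with h0 | h0
  · rw [← h0]
    positivity
  · rw [div_mul_eq_mul_div, le_div_iff₀ ha]
    refine le_of_mul_le_mul_right ?_ h0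
    linarith

/-- Monotonicity forces `⟨x, y - x⟩ ≥ 0`; expanding `‖x + (y - x)‖²` gives the claim. Allowing `b =
0` covers the zeros of `F` itself. -/
theorem MonotoneOperatorOn.sq_norm_add_sq_norm_sub_le (hF : MonotoneOperatorOn F D)
    (hx : x ∈ D) (hy : y ∈ D) (hb : 0 ≤ b) (hab : b < a) (hxa : F x + a • x = 0)
    (hyb : F y + b • y = 0) : ‖x‖ ^ 2 + ‖x - y‖ ^ 2 ≤ ‖y‖ ^ 2 := by
  have h := hF.sq_norm_sub_regularized_zeros hy hx hyb hxa
  have h1 : 0 ≤ inner ℝ x (y - x) := by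
    have h2 : 0 ≤ (a - b) * inner ℝ x (y - x) := by
      linarith [mul_nonneg hb (sq_nonneg ‖y - x‖)]
    exact nonneg_of_mul_nonneg_right h2 (sub_pos.2 hab)
  have h3 := norm_add_sq_real x (y - x)
  rw [add_sub_cancel] at h3
  rw [norm_sub_rev x y]
  linarith

/-- Regularized zeros converge to the zero of minimal norm as the parameter tends to `0`. -/
theorem exists_isMinimalNormZero [CompleteSpace H] {K : Set H} {z : H} {w : ℝ → H}
    (hF : MonotoneOperatorOn F D) (hK : IsClosed K) (hKD : K ⊆ D)
    (hFc : ∀ x ∈ K, ContinuousAt F x) (hz : z ∈ D) (hFz : F z = 0)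
    (hwK : ∀ a, 0 < a → w a ∈ K) (hw : ∀ a, 0 < a → F (w a) + a • w a = 0) :
    ∃ y, IsMinimalNormZero F D y ∧ Tendsto w (𝓝[>] 0) (𝓝 y) := by
  have hwz : ∀ x ∈ D, F x = 0 → ∀ a, 0 < a → ‖w a‖ ^ 2 + ‖w a - x‖ ^ 2 ≤ ‖x‖ ^ 2 :=
    fun x hx hFx a ha => hF.sq_norm_add_sq_norm_sub_le (hKD (hwK a ha)) hx le_rfl ha (hw a ha)
      (by rw [zero_smul, add_zero, hFx])
  have hww : ∀ a b, 0 < b → b ≤ a → ‖w a‖ ^ 2 + ‖w a - w b‖ ^ 2 ≤ ‖w b‖ ^ 2 := by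
    intro a b hb hab
    rcases hab.eq_or_lt with rfl | h
    · simp
    · exact hF.sq_norm_add_sq_norm_sub_le (hKD (hwK a (hb.trans h))) (hKD (hwK b hb)) hb.le h
        (hw a (hb.trans h)) (hw b hb)
  have hcauchy : Cauchy (map w (𝓝[>] 0)) := by
    rw [Metric.cauchy_iff]
    refine ⟨inferInstance, fun r hr => ?_⟩
    set A : Set ℝ := (fun a => ‖w a‖ ^ 2) '' Ioi 0 with hA
    have hAb : BddAbove A := by
      refine ⟨‖z‖ ^ 2, ?_⟩
      rintro _ ⟨a, ha, rfl⟩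
      linarith [hwz z hz hFz a ha, sq_nonneg ‖w a - z‖]
    -- Below `a₀` all values `‖w a‖²` lie within `r ^ 2` of their supremum, and their differences
    -- dominate `‖w a - w b‖²`.
    obtain ⟨_, ⟨a₀, ha₀, rfl⟩, hlt⟩ := exists_lt_of_lt_csSup (s := A) (b := sSup A - r ^ 2)
      ⟨_, 1, mem_Ioi.2 one_pos, rfl⟩ (by linarith [pow_pos hr 2])
    have ha₀' : 0 < a₀ := ha₀
    have key : ∀ a ∈ Ioo 0 a₀, ∀ b ∈ Ioo 0 a₀, b ≤ a → dist (w a) (w b) < r := by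
      intro a ha b hb hba
      have h1 := hww a b hb.1 hba
      have h2 := hww a₀ a ha.1 ha.2.le
      have h3 : ‖w b‖ ^ 2 ≤ sSup A := le_csSup hAb ⟨b, hb.1, rfl⟩
      rw [dist_eq_norm]
      refine lt_of_pow_lt_pow_left₀ 2 hr.le ?_
      linarith [sq_nonneg ‖w a₀ - w a‖]
    refine ⟨w '' Ioo 0 a₀, image_mem_map (Ioo_mem_nhdsGT ha₀'), ?_⟩
    rintro _ ⟨s, hs, rfl⟩ _ ⟨t, ht, rfl⟩
    rcases le_total s t with h | h
    · rw [dist_comm]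
      exact key t ht s hs h
    · exact key s hs t ht h
  obtain ⟨y, hy⟩ := cauchy_map_iff_exists_tendsto.1 hcauchy
  have hyK : y ∈ K := hK.mem_of_tendsto hy (eventually_nhdsWithin_of_forall hwK)
  have hFy : F y = 0 := by
    have h1 : Tendsto (fun a => F (w a)) (𝓝[>] 0) (𝓝 (F y)) := (hFc y hyK).tendsto.comp hy
    have h2 : Tendsto (fun a : ℝ => -(a • w a)) (𝓝[>] 0) (𝓝 (-((0 : ℝ) • y))) :=
      ((tendsto_id.mono_left nhdsWithin_le_nhds).smul hy).neg
    rw [zero_smul, neg_zero] at h2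
    refine tendsto_nhds_unique h1 (h2.congr' ?_)
    filter_upwards [self_mem_nhdsWithin] with a ha
    exact (eq_neg_of_add_eq_zero_left (hw a ha)).symm
  refine ⟨y, ⟨hKD hyK, hFy, fun x hx hFx hxy => ?_⟩, hy⟩
  have h1 : ‖y‖ ^ 2 + ‖y - x‖ ^ 2 ≤ ‖x‖ ^ 2 :=
    le_of_tendsto ((hy.norm.pow 2).add ((hy.sub_const x).norm.pow 2))
      (eventually_nhdsWithin_of_forall fun a ha => hwz x hx hFx a ha)
  have h2 : 0 < ‖y - x‖ ^ 2 := pow_pos (norm_pos_iff.2 (sub_ne_zero.2 hxy.symm)) 2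
  exact lt_of_pow_lt_pow_left₀ 2 (norm_nonneg _) (by linarith)

end RegularizedZeros

/-! ### Tracking a slowly moving target. -/

section Tracking

variable {H : Type*} [NormedAddCommGroup H] [InnerProductSpace ℝ H]

/-- Upper bound for the right slope of the squared distance between a differentiable path `u` and a
path `p` whose increments are controlled by those of `ε`. -/
theorem eventually_slope_sq_norm_sub_lt {u p : ℝ → H} {u' : H} {ε : ℝ → ℝ} {ε' C t r : ℝ}
    (hu : HasDerivWithinAt u u' (Ioi t) t) (hε : HasDerivWithinAt ε ε' (Ioi t) t) (hεt : 0 < ε t)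
    (hp : ∀ s, t < s → ‖p s - p t‖ ≤ |ε s - ε t| / ε s * C)
    (hr : 2 * inner ℝ (u t - p t) u' + 2 * ‖u t - p t‖ * (|ε'| / ε t * C) < r) :
    ∀ᶠ s in 𝓝[>] t, slope (fun s => ‖u s - p s‖ ^ 2) t s < r := by
  have hus : Tendsto (slope u t) (𝓝[>] t) (𝓝 u') :=
    (hasDerivWithinAt_iff_tendsto_slope' (by simp)).1 hu
  have hεs : Tendsto (slope ε t) (𝓝[>] t) (𝓝 ε') :=
    (hasDerivWithinAt_iff_tendsto_slope' (by simp)).1 hε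
  have huc : Tendsto u (𝓝[>] t) (𝓝 (u t)) := hu.continuousWithinAt
  have hεc : Tendsto ε (𝓝[>] t) (𝓝 (ε t)) := hε.continuousWithinAt
  have hpc : Tendsto p (𝓝[>] t) (𝓝 (p t)) := by
    rw [tendsto_iff_norm_sub_tendsto_zero]
    have h1 : Tendsto (fun s => |ε s - ε t| / ε s * C) (𝓝[>] t) (𝓝 (|ε t - ε t| / ε t * C)) :=
      ((hεc.sub_const _).abs.div hεc hεt.ne').mul_const C
    rw [sub_self, abs_zero, zero_div, zero_mul] at h1
    exact squeeze_zero' (Eventually.of_forall fun _ => norm_nonneg _)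
      (eventually_nhdsWithin_of_forall hp) h1
  -- The difference of squares is the inner product of this sum with the increment of `u - p`. As
  -- `p` may lack a derivative, its increment is only estimated.
  have hq : Tendsto (fun s => (u s - p s) + (u t - p t)) (𝓝[>] t)
      (𝓝 ((u t - p t) + (u t - p t))) := (huc.sub hpc).add_const _
  have hG := (hq.inner (𝕜 := ℝ) hus).add (hq.norm.mul ((hεs.abs.div hεc hεt.ne').mul_const C))
  have hlim : inner ℝ ((u t - p t) + (u t - p t)) u' +
      ‖(u t - p t) + (u t - p t)‖ * (|ε'| / ε t * C) < r := by
    rw [← two_smul ℝ (u t - p t), inner_smul_left, norm_smul]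
    simpa using hr
  filter_upwards [hG.eventually (gt_mem_nhds hlim), self_mem_nhdsWithin] with s hs hts
  refine lt_of_le_of_lt ?_ hs
  have hst : 0 < s - t := sub_pos.2 hts
  have e : ‖u s - p s‖ ^ 2 - ‖u t - p t‖ ^ 2 = inner ℝ ((u s - p s) + (u t - p t)) (u s - u t) -
      inner ℝ ((u s - p s) + (u t - p t)) (p s - p t) := by
    rw [← inner_sub_right, show u s - u t - (p s - p t) = (u s - p s) - (u t - p t) by abel,
      inner_sub_right, inner_add_left, inner_add_left, real_inner_self_eq_norm_sq,
      real_inner_self_eq_norm_sq, real_inner_comm (u s - p s) (u t - p t)]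
    ring
  have h1 : -inner ℝ ((u s - p s) + (u t - p t)) (p s - p t) ≤
      ‖(u s - p s) + (u t - p t)‖ * (|ε s - ε t| / ε s * C) :=
    (neg_le_abs _).trans ((abs_real_inner_le_norm _ _).trans
      (mul_le_mul_of_nonneg_left (hp s hts) (norm_nonneg _)))
  simp only [Pi.div_apply, slope_def_field, slope_def_module, inner_smul_right, abs_div,
    abs_of_pos hst]
  rw [div_le_iff₀ hst]
  have h2 : ((s - t)⁻¹ * inner ℝ ((u s - p s) + (u t - p t)) (u s - u t) +
      ‖(u s - p s) + (u t - p t)‖ * (|ε s - ε t| / (s - t) / ε s * C)) * (s - t) =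
      inner ℝ ((u s - p s) + (u t - p t)) (u s - u t) +
      ‖(u s - p s) + (u t - p t)‖ * (|ε s - ε t| / ε s * C) := by
    field_simp
  rw [h2]
  linarith

/-- A path attracted at rate `ε` to a slowly moving target `p` converges to it. -/
theorem tendsto_sub_of_slow_target {u p u' : ℝ → H} {ε : ℝ → ℝ} {C : ℝ} (hC : 0 ≤ C)
    (hu : ∀ t, 0 < t → HasDerivAt u (u' t) t)
    (hin : ∀ t, 0 < t → inner ℝ (u t - p t) (u' t) ≤ -ε t * ‖u t - p t‖ ^ 2)
    (hp : ∀ s t, 0 < s → 0 < t → ‖p s - p t‖ ≤ |ε s - ε t| / ε s * C)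
    (hε : ∀ t, 0 < t → 0 < ε t) (hεd : ∀ t, 0 < t → DifferentiableAt ℝ ε t)
    (hε0 : Tendsto ε atTop (𝓝 0))
    (hεr : Tendsto (fun t => deriv ε t / ε t ^ 2) atTop (𝓝 0)) :
    Tendsto (fun t => u t - p t) atTop (𝓝 0) := by
  have hpc : ∀ t, 0 < t → ContinuousAt p t := by
    intro t ht
    have hεc := (hεd t ht).continuousAt
    have h1 : Tendsto (fun s => |ε s - ε t| / ε s * C) (𝓝 t) (𝓝 (|ε t - ε t| / ε t * C)) :=
      ((hεc.tendsto.sub_const _).abs.div hεc.tendsto (hε t ht).ne').mul_const C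
    rw [sub_self, abs_zero, zero_div, zero_mul] at h1
    rw [ContinuousAt, tendsto_iff_norm_sub_tendsto_zero]
    refine squeeze_zero' (Eventually.of_forall fun _ => norm_nonneg _) ?_ h1
    filter_upwards [Ioi_mem_nhds ht] with s hs using hp s t hs ht
  rw [tendsto_zero_iff_norm_tendsto_zero, Metric.tendsto_atTop]
  intro r hr
  set c : ℝ := C + 1 with hc
  have hc0 : 0 < c := by positivity
  -- `δ ≤ 1` yields `ε' ≥ -ε²`; the other bound makes the constant part of the barrier at most `r /
  -- 2`.
  set δ : ℝ := min 1 (r / (4 * c)) with hδ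
  have hδ0 : 0 < δ := by positivity
  have hδ1 : δ ≤ 1 := min_le_left _ _
  have hδr : 2 * c * δ ≤ r / 2 := by
    calc 2 * c * δ ≤ 2 * c * (r / (4 * c)) := by
          gcongr
          exact min_le_right _ _
      _ = r / 2 := by field_simp; norm_num
  obtain ⟨T, hT⟩ := eventually_atTop.1 ((hεr.eventually (Metric.ball_mem_nhds 0 hδ0)).and
    (eventually_gt_atTop 0))
  have hT0 : 0 < T := (hT T le_rfl).2
  have hrate : ∀ t, T ≤ t → |deriv ε t| ≤ δ * ε t ^ 2 := fun t ht => by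
    have h1 := (hT t ht).1
    have h2 := pow_pos (hε t (hT0.trans_le ht)) 2
    rw [Real.dist_eq, sub_zero, abs_div, abs_of_pos h2, div_lt_iff₀ h2] at h1
    exact h1.le
  set A : ℝ := ‖u T - p T‖ / ε T with hA
  have hA0 : 0 ≤ A := div_nonneg (norm_nonneg _) (hε T hT0).le
  -- The constant is twice what the target's motion requires, giving strictness. `A * ε` covers the
  -- initial distance and, as `ε' ≥ -ε²`, falls no faster than the attraction permits.
  set B : ℝ → ℝ := fun t => 2 * c * δ + A * ε t with hB
  have hBpos : ∀ t, 0 < t → 0 < B t := fun t ht =>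
    add_pos_of_pos_of_nonneg (by positivity) (mul_nonneg hA0 (hε t ht).le)
  have hBd : ∀ t, 0 < t → HasDerivAt B (A * deriv ε t) t := fun t ht =>
    ((hεd t ht).hasDerivAt.const_mul A).const_add _
  have hbound : ∀ t, T ≤ t → ‖u t - p t‖ ≤ B t := by
    intro t ht
    have key := image_le_of_liminf_slope_right_lt_deriv_boundary' (a := T) (b := t)
      (f := fun s => ‖u s - p s‖ ^ 2)
      (f' := fun s => 2 * inner ℝ (u s - p s) (u' s) +
        2 * ‖u s - p s‖ * (|deriv ε s| / ε s * C))
      (B := fun s => B s ^ 2) (B' := fun s => 2 * (B s * (A * deriv ε s)))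
      (fun s hs => by
        have hs0 := hT0.trans_le hs.1
        exact (((hu s hs0).continuousAt.sub (hpc s hs0)).norm.pow 2).continuousWithinAt)
      (fun s hs q hq => by
        have hs0 := hT0.trans_le hs.1
        exact (eventually_slope_sq_norm_sub_lt (hu s hs0).hasDerivWithinAt
          (hεd s hs0).hasDerivAt.hasDerivWithinAt (hε s hs0)
          (fun q hq => hp q s (hs0.trans hq) hs0) hq).frequently)
      (by
        refine pow_le_pow_left₀ (norm_nonneg _) ?_ 2
        rw [hB, hA]
        simp only
        rw [div_mul_cancel₀ _ (hε T hT0).ne']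
        linarith [show 0 ≤ 2 * c * δ by positivity])
      (fun s hs => ((hBd s (hT0.trans_le hs.1)).continuousAt.pow 2).continuousWithinAt)
      (fun s hs => by
        convert! ((hBd s (hT0.trans_le hs.1)).pow 2).hasDerivWithinAt using 1
        ring)
      (fun s hs he => by
        have hs0 := hT0.trans_le hs.1
        have hεs := hε s hs0
        have hBs := hBpos s hs0
        have he' : ‖u s - p s‖ = B s :=
          (pow_left_inj₀ (norm_nonneg _) hBs.le two_ne_zero).1 he
        have h1 := hin s hs0
        rw [he'] at h1 ⊢
        have h2 := hrate s hs.1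
        have h3 : |deriv ε s| / ε s * C ≤ δ * ε s * c := by
          refine mul_le_mul ?_ (by linarith) hC (by positivity)
          rw [div_le_iff₀ hεs]
          linarith
        have h4 : B s * (|deriv ε s| / ε s * C) ≤ B s * (δ * ε s * c) :=
          mul_le_mul_of_nonneg_left h3 hBs.le
        have h5 : -ε s ^ 2 ≤ deriv ε s := by
          have h6 : δ * ε s ^ 2 ≤ 1 * ε s ^ 2 := by gcongr
          linarith [neg_abs_le (deriv ε s)]
        have h7 : B s * (A * -ε s ^ 2) ≤ B s * (A * deriv ε s) := by gcongr
        have h8 : B s * ε s * B s = B s * ε s * (2 * c * δ + A * ε s) := rfl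
        have h9 : 0 < B s * ε s * (c * δ) := by positivity
        linarith) ⟨ht, le_rfl⟩
    exact (pow_le_pow_iff_left₀ (norm_nonneg _) (hBpos t (hT0.trans_le ht)).le two_ne_zero).1 key
  have hAε : Tendsto (fun t => A * ε t) atTop (𝓝 0) := by
    simpa using hε0.const_mul A
  obtain ⟨N, hN⟩ := eventually_atTop.1 (hAε.eventually (gt_mem_nhds (half_pos hr)))
  refine ⟨max T N, fun t ht => ?_⟩
  rw [Real.dist_eq, sub_zero, abs_norm]
  have h1 := hbound t ((le_max_left _ _).trans ht)
  have h2 := hN t ((le_max_right _ _).trans ht)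
  simp only [hB] at h1
  linarith

end Tracking

/-! ### Assembly of the theorem. -/

theorem theorem4p3 {H : Type*} [NormedAddCommGroup H] [InnerProductSpace ℝ H] [CompleteSpace H]
    (D : Set H) (F : H → H) (u₀ z : H) (R M₁ M₂ : ℝ) (ε : ℝ → ℝ)
    (hR : 0 < R)
    (hBD : closedBall u₀ R ⊆ D)
    (hrD : closedBall u₀ (3 * (‖z‖ + ‖u₀‖)) ⊆ D)
    (hmono : MonotoneOperatorOn F D)
    (hlip : LocallyLipschitzOn D F)
    (hderiv : HasBoundedDerivatives F u₀ R M₁ M₂)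
    (hz : z ∈ closedBall u₀ R)
    (hFz : F z = 0)
    (hεpos : ∀ t : ℝ, 0 ≤ t → 0 < ε t)
    (hεcont : ContinuousOn ε (Ici 0))
    (hεanti : AntitoneOn ε (Ici 0))
    (hεlim : Tendsto ε atTop (𝓝 0))
    (hεdiff : ∀ t : ℝ, 0 < t → DifferentiableAt ℝ ε t)
    (hεrate : Tendsto (fun t : ℝ => deriv ε t / ε t ^ 2) atTop (𝓝 0)) :
    ∃ (u : ℝ → H) (y : H),
      IsGlobalSolution (fun t x => -F x - ε t • x) D u₀ u ∧
      (∀ v : ℝ → H, IsGlobalSolution (fun t x => -F x - ε t • x) D u₀ v →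
        EqOn v u (Ici 0)) ∧
      IsMinimalNormZero F D y ∧
      Tendsto u atTop (𝓝 y) := by
  have hzD : z ∈ D := hBD hz
  obtain ⟨U, hU, hUD, hK⟩ :
      ∃ U, IsOpen U ∧ U ⊆ D ∧ closedBall z (max ‖u₀ - z‖ ‖z‖) ⊆ U := by
    have hn : 0 ≤ ‖z‖ + ‖u₀‖ := by positivity
    -- With `n = ‖z‖ + ‖u₀‖`, the radius and the centre's distance from `u₀` are each at most `n`,
    -- and `2 * n < 3 * n` unless `n = 0`. In that case the a priori ball is a point, and the ball
    -- of radius `R` serves.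
    rcases hn.eq_or_lt with h | h
    · have hz0 : z = 0 := norm_eq_zero.1 (by linarith [norm_nonneg z, norm_nonneg u₀])
      have hu0 : u₀ = 0 := norm_eq_zero.1 (by linarith [norm_nonneg z, norm_nonneg u₀])
      refine ⟨ball u₀ R, isOpen_ball, ball_subset_closedBall.trans hBD, ?_⟩
      simp [hz0, hu0, hR]
    · refine ⟨ball u₀ (3 * (‖z‖ + ‖u₀‖)), isOpen_ball, ball_subset_closedBall.trans hrD, ?_⟩
      refine closedBall_subset_ball' ?_
      have h1 : max ‖u₀ - z‖ ‖z‖ ≤ ‖z‖ + ‖u₀‖ :=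
        max_le (by linarith [norm_sub_le u₀ z]) (by linarith [norm_nonneg u₀])
      rw [dist_eq_norm]
      linarith [norm_sub_le z u₀]
  obtain ⟨u, hu⟩ := exists_isGlobalSolution_regularized hU hUD hmono hlip hzD hFz hK hεpos hεcont
  have hreg : ∀ a : ℝ, 0 < a → ∃ w ∈ closedBall z (max ‖u₀ - z‖ ‖z‖), F w + a • w = 0 :=
    fun a ha => exists_regularized_zero hU hUD hmono hlip hzD hFz hK ha
  choose! w hwK hw using hreg
  obtain ⟨y, hy, hwy⟩ := exists_isMinimalNormZero hmono isClosed_closedBall (hK.trans hUD)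
    (fun x hx => hlip.continuousAt_of_isOpen hU hUD (hK hx)) hzD hFz hwK hw
  have hwD : ∀ a, 0 < a → w a ∈ D := fun a ha => hUD (hK (hwK a ha))
  refine ⟨u, y, hu, fun v hv t ht => ?_, hy, ?_⟩
  · exact (hv.isSolutionUpTo t).eqOn hmono hεpos (hu.isSolutionUpTo t) ⟨ht, le_rfl⟩
  have hwC : ∀ a, 0 < a → ‖w a‖ ≤ ‖z‖ + max ‖u₀ - z‖ ‖z‖ := fun a ha => by
    have h1 := hwK a ha
    rw [mem_closedBall, dist_eq_norm] at h1
    linarith [norm_le_norm_add_norm_sub' (w a) z]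
  have htrack : Tendsto (fun t => u t - w (ε t)) atTop (𝓝 0) := by
    refine tendsto_sub_of_slow_target (C := ‖z‖ + max ‖u₀ - z‖ ‖z‖)
      (u' := fun t => -F (u t) - ε t • u t) (by positivity)
      (fun t ht => (hu.2 t ht.le).2.hasDerivAt (Ici_mem_nhds ht)) (fun t ht => ?_)
      (fun s t hs ht => ?_) (fun t ht => hεpos t ht.le) hεdiff hεlim hεrate
    · have hεt := hεpos t ht.le
      have h1 := hmono.inner_sub_regularized_le (hu.2 t ht.le).1 (hwD _ hεt) (ε t) (ε t)
      have h2 : -F (w (ε t)) - ε t • w (ε t) = 0 := by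
        rw [← neg_add', hw _ hεt, neg_zero]
      rw [h2, sub_zero, sub_self, zero_mul, sub_zero] at h1
      exact h1
    · have hs' := hεpos s hs.le
      have ht' := hεpos t ht.le
      refine (hmono.norm_sub_regularized_zeros_le (hwD _ hs') (hwD _ ht') hs' (hw _ hs')
        (hw _ ht')).trans ?_
      have := hwC _ ht'
      gcongr
  have hwε : Tendsto (fun t => w (ε t)) atTop (𝓝 y) := by
    refine hwy.comp (tendsto_nhdsWithin_iff.2 ⟨hεlim, ?_⟩)
    filter_upwards [eventually_ge_atTop 0] with t ht using hεpos t ht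
  simpa using htrack.add hwε
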